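/- All rings are commutative with identity. Let $S$ be an integrally closed domain, let $C\subseteq S$ be a multiplicatively closed subset with $1\in C$, and let $K$ be an $S$-module such that the elements of $C$ are nonzerodivisors on $S$ and on $K$. Write $S_C$, $K_C$ for the localizations at $C$. Let $R$ be a subring of $S$ that is twisted by $K$ along $C$; that is, there is a derivation $D:S_C\to K_C$ with $D(c)=0$ for all $c\in C$ such that (a) $R=S\cap D^{-1}(K)$, (b) $D(S_C)$ generates $K_C$ as an $S_C$-module, and (c) $S\subseteq \operatorname{Ker} D+cS$ for all $c\in C$. An ideal of a domain is stable if it is projective as a module over its ring of endomorphisms; a domain is finitely stable if each of its nonzero finitely generated ideals is stable, and stable if each of its ideals is stable. A domain is Prüfer if each of its nonzero finitely generated ideals is invertible. The set of height one primes of a domain has finite character if every nonzero element lies in at most finitely many of them. A domain $S$ is Krull if $S_Q$ is a discrete valuation ring for every height one prime $Q$, $S=\bigcap_Q S_Q$ (intersection over the height one primes, inside the quotient field; the empty intersection is the quotient field), and the set of height one primes of $S$ has finite character. Then: (1) $S$ is a Prüfer domain if and only if $R$ is a finitely stable domain. (2) $S$ is a Dedekind domain that is not a field if and only if $R$ is a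 stable domain of Krull dimension $1$. (3) $S$ is a Krull domain if and only if $S$ is the intersection of its localizations at height one prime ideals, the set of height one prime ideals of $R$ has finite character, and for each height one prime ideal $P$ of $R$ the localization $R_P$ is a stable domain. -/

import Mathlib

open scoped nonZeroDivisors

universe u v

/-- The subring `R` of `S` is twisted by the `S`-module `K` along the multiplicatively closed set
`C`: the elements of `C` are nonzerodivisors on `S` and on `K`, and there is a derivation
`D : S_C → K_C` vanishing on `C` (that is, `D` is `C`-linear) which satisfies (a), (b), (c) below.
Here `S_C` is `Localization C` and `K_C` is `LocalizedModule C K`. -/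
structure IsTwistedAlong {S : Type u} [CommRing S] (R : Subring S) (C : Submonoid S)
    (K : Type v) [AddCommGroup K] [Module S K] : Prop where
  /-- elements of `C` are nonzerodivisors of `S` -/
  le_nonZeroDivisors : C ≤ S⁰
  /-- elements of `C` are nonzerodivisors on `K`, i.e. `K` is `C`-torsion-free -/
  torsionFree : ∀ c ∈ C, ∀ k : K, c • k = 0 → k = 0
  exists_derivation : ∃ D : Derivation ℤ (Localization C) (LocalizedModule C K),
    (∀ c ∈ C, D (algebraMap S (Localization C) c) = 0) ∧
    -- (a) `R = S ∩ D⁻¹(K)`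
    (∀ s : S, s ∈ R ↔
      ∃ k : K, D (algebraMap S (Localization C) s) = LocalizedModule.mkLinearMap C K k) ∧
    -- (b) `D(S_C)` generates `K_C` as an `S_C`-module
    Submodule.span (Localization C) (Set.range D) = ⊤ ∧
    -- (c) `S ⊆ Ker D + cS` for all `c ∈ C`
    (∀ c ∈ C, ∀ s : S, ∃ x : Localization C, D x = 0 ∧ ∃ t : S,
      algebraMap S (Localization C) s = x + algebraMap S (Localization C) (c * t))

/-- An ideal is stable if it is projective as a module over its ring of endomorphisms. -/
def IsStableIdeal {R : Type u} [CommRing R] (I : Ideal R) : Prop :=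
  Module.Projective (Module.End R I) I

/-- A finitely stable domain: every nonzero finitely generated ideal is stable. -/
def IsFinitelyStableDomain (R : Type u) [CommRing R] : Prop :=
  IsDomain R ∧ ∀ I : Ideal R, I ≠ ⊥ → I.FG → IsStableIdeal I

/-- A stable domain: every ideal is stable. -/
def IsStableDomain (R : Type u) [CommRing R] : Prop :=
  IsDomain R ∧ ∀ I : Ideal R, IsStableIdeal I

/-- A Prüfer domain: every nonzero finitely generated ideal is invertible. -/
def IsPruferDomain (S : Type u) [CommRing S] [IsDomain S] : Prop :=
  ∀ I : Ideal S, I ≠ ⊥ → I.FG → IsUnit (I : FractionalIdeal S⁰ (FractionRing S))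

/-- The set of height one primes of `R` has finite character: every nonzero element of `R`
lies in at most finitely many of them. -/
def HeightOneFiniteCharacter (R : Type u) [CommRing R] : Prop :=
  ∀ r : R, r ≠ 0 → {P : PrimeSpectrum R | P.asIdeal.height = 1 ∧ r ∈ P.asIdeal}.Finite

/-- The domain `S` is the intersection, inside its quotient field, of its localizations at its
height one primes (an empty intersection being the whole quotient field). -/
def IsInterHeightOneLocalizations (S : Type u) [CommRing S] [IsDomain S] : Prop :=
  ⨅ Q : {Q : PrimeSpectrum S // Q.asIdeal.height = 1},
    Localization.subalgebra.ofField (FractionRing S) Q.1.asIdeal.primeCompl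
      Q.1.asIdeal.primeCompl_le_nonZeroDivisors = ⊥

/-- A Krull domain: the localizations at height one primes are discrete valuation rings, their
intersection is the domain, and the set of height one primes has finite character. -/
structure IsKrullDomain (S : Type u) [CommRing S] [IsDomain S] : Prop where
  isDVR : ∀ Q : PrimeSpectrum S, Q.asIdeal.height = 1 →
    IsDiscreteValuationRing (Localization.AtPrime Q.asIdeal)
  isInter : IsInterHeightOneLocalizations S
  finiteCharacter : HeightOneFiniteCharacter S

/-! The derivation matters only through `IsTightQuadraticExtension`. By (c), each s is a + ct with a
in the kernel of D, hence in R, and c in C. If c clears enough denominators, the Leibniz rule puts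
products of two elements ct in R. So st ∈ Rs + Rt + R for all s, t in S, and contraction identifies
the spectra of S and R. A nonzero ideal I of R is stable iff it is invertible over (I : I), and this
is compared with invertibility of IS. If IS is invertible, it is generated locally by some x ∈ I;
the quadratic relation for a/x and b/x gives I² = xI locally, so I is stable
(`isStableIdeal_of_isUnit_map`). Conversely, if I is stable and (I : I) ⊆ S, then IS is invertible
(`IsStableIdeal.isUnit_map`). The inclusion holds for finitely generated I because S is integrally
closed, and for I extending to a maximal ideal Q of a Prüfer domain because (Q : Q) = S. This yields
(1); applied to contractions of maximal ideals it yields (2), and after localizing at height one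
primes, (3). -/

/-! ### Invertible and stable ideals, with denominators cleared -/

lemma isUnit_coeIdeal_iff_exists_mul_eq_span {S : Type*} [CommRing S] [IsDomain S] (I : Ideal S) :
    IsUnit (I : FractionalIdeal S⁰ (FractionRing S)) ↔
      ∃ z : S, z ≠ 0 ∧ ∃ J : Ideal S, I * J = Ideal.span {z} := by
  constructor
  · intro h
    obtain ⟨a, J, ha, hJ⟩ := FractionalIdeal.exists_eq_spanSingleton_mul
      (I : FractionalIdeal S⁰ (FractionRing S))⁻¹
    refine ⟨a, ha, J, ?_⟩
    have h1 : (I : FractionalIdeal S⁰ (FractionRing S)) * (I : FractionalIdeal S⁰ _)⁻¹ = 1 :=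
      FractionalIdeal.mul_inv_cancel_iff_isUnit _ |>.mpr h
    rw [hJ] at h1
    have ha' : algebraMap S (FractionRing S) a ≠ 0 := by simpa using ha
    rw [← FractionalIdeal.coeIdeal_inj (K := FractionRing S), FractionalIdeal.coeIdeal_mul,
      FractionalIdeal.coeIdeal_span_singleton]
    calc (I : FractionalIdeal S⁰ (FractionRing S)) * J
        = FractionalIdeal.spanSingleton S⁰ (algebraMap S (FractionRing S) a) *
          (I * (FractionalIdeal.spanSingleton S⁰ (algebraMap S (FractionRing S) a)⁻¹ * J)) := by
          rw [mul_left_comm _ (FractionalIdeal.spanSingleton _ _), ← mul_assoc,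
            FractionalIdeal.spanSingleton_mul_spanSingleton, mul_inv_cancel₀ ha',
            FractionalIdeal.spanSingleton_one, one_mul]
      _ = _ := by rw [h1, mul_one]
  · rintro ⟨z, hz, J, h⟩
    have hz' : algebraMap S (FractionRing S) z ≠ 0 := by simpa using hz
    refine isUnit_of_mul_isUnit_left (y := (J : FractionalIdeal S⁰ (FractionRing S))) ?_
    rw [← FractionalIdeal.coeIdeal_mul, h, FractionalIdeal.coeIdeal_span_singleton]
    refine IsUnit.of_mul_eq_one
      (FractionalIdeal.spanSingleton S⁰ (algebraMap S (FractionRing S) z)⁻¹) ?_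
    rw [FractionalIdeal.spanSingleton_mul_spanSingleton, mul_inv_cancel₀ hz',
      FractionalIdeal.spanSingleton_one]

lemma isStableIdeal_bot (R : Type u) [CommRing R] : IsStableIdeal (⊥ : Ideal R) :=
  ⟨0, fun _ => Subsingleton.elim _ _⟩

/-- Both sides are f(ab). Over a domain, f is therefore multiplication by a fraction, an element of
(I : I). -/
lemma Ideal.end_apply_mul {R : Type*} [CommRing R] {I : Ideal R} (f : Module.End R I) (a b : I) :
    (f a : R) * b = a * f b := by
  have h : (b : R) • f a = (a : R) • f b := by
    rw [← map_smul, ← map_smul]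
    congr 1
    ext
    simp [mul_comm]
  simpa [mul_comm] using congrArg Subtype.val h

/-- A nonzero stable ideal is invertible over its endomorphism ring `(I : I)`. -/
lemma IsStableIdeal.exists_mul_le {R : Type u} [CommRing R] [IsDomain R] {I : Ideal R}
    (hI : I ≠ ⊥) (h : IsStableIdeal I) :
    ∃ z : R, z ≠ 0 ∧ ∃ J : Ideal R, J * (I * I) ≤ Ideal.span {z} * I ∧ z ∈ I * J := by
  obtain ⟨s, hs⟩ := h.out
  obtain ⟨x, hxI, hx⟩ := Submodule.exists_mem_ne_zero_of_ne_bot hI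
  let X : I := ⟨x, hxI⟩
  have hsmul : ∀ (b : I) (i : I), (b : R) • s X i = x • s b i := by
    intro b i
    have h1 : (b : R) • X = x • b := by ext; simp [X, mul_comm]
    have h2 (r : R) (y : I) : s (r • y) = (algebraMap R (Module.End R I) r) • s y := by
      rw [← map_smul]; rfl
    have h3 := congrArg (fun t => t i) (congrArg s h1)
    simp only [h2] at h3
    ext a
    simpa using congrArg Subtype.val (DFunLike.congr_fun h3 a)
  have hval : ∀ (a b i : I), (s X i X : R) * a * b = x * x * (s b i a : R) := by
    intro a b i
    have h1 := congrArg Subtype.val (DFunLike.congr_fun (hsmul b i) a)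
    have h2 := Ideal.end_apply_mul (s X i) X a
    simp only [LinearMap.smul_apply, Submodule.coe_smul, smul_eq_mul] at h1
    rw [h2, mul_assoc, mul_comm _ (b : R), h1]
    simp [X, mul_assoc]
  -- By `hval`, the i-th coordinate of the section `s` is b ↦ q_i b with q_i = s(x)_i(x)/x², and ∑
  -- q_i i = 1. The factor x² clears the denominators of the q_i.
  refine ⟨x * x, mul_ne_zero hx hx, Ideal.span (Set.range fun i : I => (s X i X : R)), ?_, ?_⟩
  · rw [Ideal.mul_le]
    intro y hy c hc
    induction hy using Submodule.span_induction with
    | zero => simp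
    | add y y' _ _ h1 h2 => rw [add_mul]; exact add_mem h1 h2
    | smul r y _ h => rw [smul_eq_mul, mul_assoc]; exact Ideal.mul_mem_left _ _ h
    | mem y hy =>
      obtain ⟨i, rfl⟩ := hy
      induction hc using Submodule.mul_induction_on' with
      | mem_mul_mem a ha b hb =>
        rw [Ideal.mem_span_singleton_mul]
        exact ⟨_, (s ⟨b, hb⟩ i ⟨a, ha⟩).2, by rw [← hval]; simp [mul_assoc]⟩
      | add a _ b _ h1 h2 => rw [mul_add]; exact add_mem h1 h2
  · have h1 := congrArg Subtype.val (congrArg (fun y => x • y) (hs X))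
    rw [Finsupp.linearCombination_apply, Finsupp.sum, Finset.smul_sum] at h1
    simp only [id, Submodule.coe_smul, smul_eq_mul, AddSubmonoidClass.coe_finsetSum] at h1
    change _ = x * x at h1
    rw [← h1]
    refine Ideal.sum_mem _ fun i _ => ?_
    have h2 : x * (s X i • i : I).1 = i * (s X i X) := Ideal.end_apply_mul (s X i) i X ▸ by
      rw [mul_comm]; rfl
    rw [h2]
    exact Ideal.mul_mem_mul i.2 (Ideal.subset_span ⟨i, rfl⟩)

/-- Dual basis argument: each y ∈ J gives the functional b ↦ (multiplication by yb/z) from I to its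
endomorphism ring, and writing z as a sum of products xy supplies the dual basis. -/
lemma IsStableIdeal.of_exists_mul_le {R : Type u} [CommRing R] [IsDomain R] {I J : Ideal R}
    {z : R} (hz : z ≠ 0) (hJ : J * (I * I) ≤ Ideal.span {z} * I) (hzJ : z ∈ I * J) :
    IsStableIdeal I := by
  have key : ∀ y ∈ J, ∃ ψ : I →ₗ[Module.End R I] Module.End R I,
      ∀ a b : I, z * (ψ b a : R) = y * a * b := by
    intro y hy
    have h1 : ∀ a b : I, ∃ m : I, z * (m : R) = y * a * b := by
      intro a b
      obtain ⟨m, hm, h⟩ := Ideal.mem_span_singleton_mul.1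
        (hJ (Ideal.mul_mem_mul hy (Ideal.mul_mem_mul a.2 b.2)))
      exact ⟨⟨m, hm⟩, by rw [h, mul_assoc]⟩
    choose m hm using h1
    have hext : ∀ a b : I, z * (a : R) = z * b → a = b := fun a b h =>
      Subtype.ext (mul_left_cancel₀ hz h)
    refine ⟨⟨⟨fun b => ⟨⟨fun a => m a b, ?_⟩, ?_⟩, ?_⟩, ?_⟩, hm⟩
    · intro a a'
      refine hext _ _ ?_
      rw [Submodule.coe_add, mul_add, hm, hm, hm, Submodule.coe_add]; ring
    · intro r a
      refine hext _ _ ?_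
      simp only [RingHom.id_apply, Submodule.coe_smul, smul_eq_mul]
      rw [hm, mul_left_comm, hm, Submodule.coe_smul, smul_eq_mul]; ring
    · intro b b'
      ext a
      refine mul_left_cancel₀ hz ?_
      change z * (m a (b + b') : R) = z * (m a b + m a b' : I)
      rw [Submodule.coe_add, mul_add, hm, hm, hm, Submodule.coe_add]; ring
    · intro f b
      ext a
      refine mul_left_cancel₀ hz ?_
      change z * (m a (f b) : R) = z * (f (m a b))
      have h2 : z • m a b = (y * a : R) • b := Subtype.ext (hm a b)
      have h3 := congrArg Subtype.val (congrArg f h2)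
      rw [map_smul, map_smul] at h3
      rw [hm]
      exact h3.symm
  choose! ψ hψ using key
  have key' : ∃ g : I →ₗ[Module.End R I] (I →₀ Module.End R I), ∀ b : I,
      z * (Finsupp.linearCombination (Module.End R I) id (g b) : I) = z * (b : R) := by
    have hmem : ∀ c ∈ I * J, ∃ g : I →ₗ[Module.End R I] (I →₀ Module.End R I), ∀ b : I,
        z * ((Finsupp.linearCombination (Module.End R I) id (g b) : I) : R) = c * b := by
      intro c hc
      induction hc using Submodule.mul_induction_on' with
      | mem_mul_mem x hx y hy =>
        refine ⟨(Finsupp.lsingle (⟨x, hx⟩ : I)).comp (ψ y), fun b => ?_⟩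
        simp only [LinearMap.comp_apply, Finsupp.lsingle_apply,
          Finsupp.linearCombination_single, id]
        rw [Module.End.smul_def, hψ y hy]
        ring
      | add x _ y _ hx hy =>
        obtain ⟨g, hg⟩ := hx
        obtain ⟨g', hg'⟩ := hy
        refine ⟨g + g', fun b => ?_⟩
        rw [LinearMap.add_apply, map_add, Submodule.coe_add, mul_add, hg, hg', add_mul]
    exact hmem z hzJ
  obtain ⟨g, hg⟩ := key'
  exact ⟨g, fun b => Subtype.ext (mul_left_cancel₀ hz (hg b))⟩

/-! ### From the derivation to a quadratic extension -/

/-- The properties of the extension `R ⊆ S` of a twisted subring that do not mention derivations: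
`S` is a quadratic extension of `R` with the same quotient field, and the primes of `S` are
determined locally by their contractions to `R`. -/
structure IsTightQuadraticExtension (R S : Type*) [CommRing R] [CommRing S] [Algebra R S] :
    Prop where
  exists_mul_eq : ∀ s : S, ∃ c : R, c ≠ 0 ∧ ∃ r : R, algebraMap R S r = algebraMap R S c * s
  quadratic : ∀ s t : S, ∃ r₁ r₂ r₃ : R,
    s * t = algebraMap R S r₁ * s + algebraMap R S r₂ * t + algebraMap R S r₃
  exists_mul_notMem : ∀ Q : Ideal S, Q.IsPrime → ∀ u ∉ Q,
    ∃ v : S, ∃ r : R, algebraMap R S r = u * v ∧ r ∉ Q.comap (algebraMap R S)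
  exists_mul_mem_map : ∀ Q : Ideal S, Q.IsPrime → ∀ s ∈ Q, ∃ d ∉ Q.comap (algebraMap R S),
    algebraMap R S d * s ∈ (Q.comap (algebraMap R S)).map (algebraMap R S)

lemma isTightQuadraticExtension_of_derivation {S M : Type*} [CommRing S] [AddCommGroup M]
    [Module S M] {R : Subring S} {C : Submonoid S} (hC : (0 : S) ∉ C) (δ : Derivation ℤ S M)
    (N : Submodule S M) (hN : ∀ m : M, ∃ c ∈ C, c • m ∈ N) (hδ : ∀ c ∈ C, δ c = 0)
    (hR : ∀ s, s ∈ R ↔ δ s ∈ N) (hdiv : ∀ c ∈ C, ∀ s, ∃ a t, δ a = 0 ∧ s = a + c * t) :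
    IsTightQuadraticExtension R S := by
  have hCR : ∀ c ∈ C, c ∈ R := fun c hc => (hR c).2 (by rw [hδ c hc]; exact zero_mem _)
  have hsmul : ∀ c ∈ C, ∀ s, δ (c * s) = c • δ s := fun c hc s => by
    rw [δ.leibniz, hδ c hc, smul_zero, add_zero]
  have hdecomp : ∀ c ∈ C, ∀ s, c • δ s ∈ N → ∃ a t, δ a = 0 ∧ s = a + c * t ∧
      (c * c) • δ t ∈ N := by
    intro c hc s hs
    obtain ⟨a, t, ha, rfl⟩ := hdiv c hc s
    refine ⟨a, t, ha, rfl, ?_⟩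
    rwa [map_add, ha, zero_add, hsmul c hc, smul_smul] at hs
  have hker : ∀ a, δ a = 0 → a ∈ R := fun a ha => (hR a).2 (by rw [ha]; exact zero_mem _)
  have hmul : ∀ c ∈ C, ∀ t v, (c * c) • δ t ∈ N → (c * c) • δ v ∈ N → c * t * (c * v) ∈ R := by
    intro c hc t v ht hv
    rw [hR, show c * t * (c * v) = (c * c) * (t * v) by ring, hsmul _ (mul_mem hc hc), δ.leibniz,
      smul_add, smul_comm _ t, smul_comm _ v]
    exact add_mem (N.smul_mem _ hv) (N.smul_mem _ ht)
  refine ⟨fun s => ?_, fun s t => ?_, fun Q hQ u hu => ?_, fun Q hQ s hs => ?_⟩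
  · obtain ⟨c, hc, h⟩ := hN (δ s)
    refine ⟨⟨c, hCR c hc⟩, fun h0 => hC ?_, ⟨c * s, (hR _).2 (by rwa [hsmul c hc])⟩, rfl⟩
    have h1 : c = 0 := congrArg Subtype.val h0
    exact h1 ▸ hc
  · obtain ⟨c, hc, hs⟩ := hN (δ s)
    obtain ⟨d, hd, ht⟩ := hN (δ t)
    obtain ⟨a, s', ha, rfl, hs'⟩ := hdecomp (d * c) (mul_mem hd hc) s
      (by rw [mul_smul]; exact N.smul_mem _ hs)
    obtain ⟨b, t', hb, rfl, ht'⟩ := hdecomp (d * c) (mul_mem hd hc) t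
      (by rw [mul_comm, mul_smul]; exact N.smul_mem _ ht)
    -- With s = a + p and t = b + q, where pq ∈ R, one has st = bs + at + (pq - ab).
    refine ⟨⟨b, hker b hb⟩, ⟨a, hker a ha⟩,
      ⟨_, hmul _ (mul_mem hd hc) s' t' hs' ht'⟩ - ⟨a, hker a ha⟩ * ⟨b, hker b hb⟩, ?_⟩
    change _ = b * _ + a * _ + (d * c * s' * (d * c * t') - a * b)
    ring
  · obtain ⟨c, hc, h⟩ := hN (δ u)
    by_cases hcQ : c ∈ Q
    · obtain ⟨a, t, ha, rfl, ht⟩ := hdecomp c hc u h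
      -- Multiplying u = a + ct by its conjugate ct - a gives (ct)² - a² ∈ R, which is -a² modulo Q;
      -- and a ∉ Q because ct ∈ Q and u ∉ Q.
      refine ⟨c * t - a, ⟨_, hmul c hc t t ht ht⟩ - ⟨a, hker a ha⟩ * ⟨a, hker a ha⟩, ?_, ?_⟩
      · change c * t * (c * t) - a * a = _
        ring
      · intro hmem
        change c * t * (c * t) - a * a ∈ Q at hmem
        have h1 : c * t ∈ Q := Q.mul_mem_right _ hcQ
        have h2 : a * a ∈ Q := by simpa using Q.sub_mem (Q.mul_mem_right (c * t) h1) hmem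
        exact hu (add_mem ((hQ.mem_or_mem h2).elim id id) h1)
    · refine ⟨c, ⟨c * u, (hR _).2 (by rwa [hsmul c hc])⟩, mul_comm _ _, fun hmem => ?_⟩
      exact (hQ.mem_or_mem (show c * u ∈ Q from hmem)).elim hcQ hu
  · obtain ⟨c, hc, h⟩ := hN (δ s)
    by_cases hcQ : c ∈ Q
    · obtain ⟨a, t, ha, rfl⟩ := hdiv c hc s
      refine ⟨1, fun h1 => hQ.ne_top ((Ideal.eq_top_iff_one _).2 (by simpa using h1)), ?_⟩
      have haQ : a ∈ Q := by simpa using Q.sub_mem hs (Q.mul_mem_right t hcQ)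
      rw [map_one, one_mul]
      exact add_mem (Ideal.mem_map_of_mem (algebraMap R S) (x := ⟨a, hker a ha⟩) haQ)
        (Ideal.mul_mem_right _ _
          (Ideal.mem_map_of_mem (algebraMap R S) (x := ⟨c, hCR c hc⟩) hcQ))
    · exact ⟨⟨c, hCR c hc⟩, hcQ, Ideal.mem_map_of_mem (algebraMap R S)
        (x := ⟨c * s, (hR _).2 (by rwa [hsmul c hc])⟩) (Q.mul_mem_left _ hs)⟩

lemma IsTwistedAlong.isTightQuadraticExtension {S : Type u} [CommRing S] [IsDomain S]
    {C : Submonoid S} {R : Subring S} {K : Type v} [AddCommGroup K] [Module S K]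
    (h : IsTwistedAlong R C K) : IsTightQuadraticExtension R S := by
  obtain ⟨D, hDC, hR, -, hdiv⟩ := h.exists_derivation
  refine isTightQuadraticExtension_of_derivation (C := C)
    (fun h0 => zero_notMem_nonZeroDivisors (h.le_nonZeroDivisors h0))
    (D.compAlgebraMap S) (LinearMap.range (LocalizedModule.mkLinearMap C K)) ?_ hDC ?_ ?_
  · intro m
    obtain ⟨⟨k, c⟩, hk⟩ := IsLocalizedModule.surj C (LocalizedModule.mkLinearMap C K) m
    exact ⟨c, c.2, k, hk.symm⟩
  · intro s
    rw [hR, LinearMap.mem_range]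
    exact exists_congr fun k => eq_comm
  · intro c hc s
    obtain ⟨x, hx, t, hs⟩ := hdiv c hc s
    refine ⟨s - c * t, t, ?_, by ring⟩
    change D (algebraMap S (Localization C) (s - c * t)) = 0
    rw [map_sub, hs, add_sub_cancel_right, hx]

/-! ### Comparison of spectra, heights and finite character -/

namespace IsTightQuadraticExtension

variable {R S : Type*} [CommRing R] [CommRing S] [Algebra R S]

lemma isIntegral (h : IsTightQuadraticExtension R S) : Algebra.IsIntegral R S := by
  refine ⟨fun s => ?_⟩
  nontriviality R
  obtain ⟨r₁, r₂, r₃, hs⟩ := h.quadratic s s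
  refine ⟨Polynomial.X ^ 2 - (Polynomial.C (r₁ + r₂) * Polynomial.X + Polynomial.C r₃), ?_, ?_⟩
  · refine Polynomial.monic_X_pow_sub (n := 2) (Polynomial.degree_linear_lt.trans_le ?_)
    norm_num
  · simp only [Polynomial.eval₂_sub, Polynomial.eval₂_add, Polynomial.eval₂_mul,
      Polynomial.eval₂_C, Polynomial.eval₂_X, Polynomial.eval₂_pow, map_add]
    rw [pow_two, hs]
    ring

lemma le_of_comap_le (h : IsTightQuadraticExtension R S) {Q Q' : Ideal S} [Q'.IsPrime]
    (hle : Q.comap (algebraMap R S) ≤ Q'.comap (algebraMap R S)) : Q ≤ Q' := by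
  intro u hu
  by_contra hu'
  obtain ⟨v, r, hr, hrQ⟩ := h.exists_mul_notMem Q' ‹_› u hu'
  exact hrQ (hle (by rw [Ideal.mem_comap, hr]; exact Q.mul_mem_right _ hu))

/-- Contraction of primes is an isomorphism of the spectra. -/
noncomputable def specOrderIso [FaithfulSMul R S] (h : IsTightQuadraticExtension R S) :
    PrimeSpectrum S ≃o PrimeSpectrum R :=
  have := h.isIntegral
  RelIso.ofSurjective (OrderEmbedding.ofMapLEIff (PrimeSpectrum.comap (algebraMap R S))
    fun _ _ => ⟨fun hle => h.le_of_comap_le hle, fun hle => Ideal.comap_mono hle⟩)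
    (Algebra.IsIntegral.comap_surjective R S)

@[simp]
lemma specOrderIso_asIdeal [FaithfulSMul R S] (h : IsTightQuadraticExtension R S)
    (Q : PrimeSpectrum S) : (h.specOrderIso Q).asIdeal = Q.asIdeal.comap (algebraMap R S) := rfl

lemma height_comap [FaithfulSMul R S] (h : IsTightQuadraticExtension R S) (Q : PrimeSpectrum S) :
    (Q.asIdeal.comap (algebraMap R S)).height = Q.asIdeal.height := by
  rw [← h.specOrderIso_asIdeal, PrimeSpectrum.height_eq_orderHeight,
    PrimeSpectrum.height_eq_orderHeight, Order.height_orderIso]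

lemma ringKrullDim_eq [FaithfulSMul R S] (h : IsTightQuadraticExtension R S) :
    ringKrullDim S = ringKrullDim R :=
  Order.krullDim_eq_of_orderIso h.specOrderIso

/-- Whether the height one primes have finite character depends only on the integral closure. -/
lemma heightOneFiniteCharacter_iff [IsDomain S] [FaithfulSMul R S]
    (h : IsTightQuadraticExtension R S) :
    HeightOneFiniteCharacter R ↔ HeightOneFiniteCharacter S := by
  constructor
  · intro hR s hs
    obtain ⟨c, hc, r, hr⟩ := h.exists_mul_eq s
    have hr0 : r ≠ 0 := by
      rintro rfl
      rw [map_zero, eq_comm, mul_eq_zero, FaithfulSMul.algebraMap_eq_zero_iff] at hr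
      exact hr.elim hc hs
    refine Set.Finite.of_injOn (f := h.specOrderIso) ?_ h.specOrderIso.injective.injOn (hR r hr0)
    rintro Q ⟨hQ, hsQ⟩
    refine ⟨by rw [specOrderIso_asIdeal, h.height_comap, hQ], ?_⟩
    rw [specOrderIso_asIdeal, Ideal.mem_comap, hr]
    exact Ideal.mul_mem_left _ _ hsQ
  · intro hS r hr
    refine Set.Finite.of_injOn (f := h.specOrderIso.symm) ?_ h.specOrderIso.symm.injective.injOn
      (hS (algebraMap R S r) ((FaithfulSMul.algebraMap_eq_zero_iff R S).not.2 hr))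
    rintro P ⟨hP, hrP⟩
    obtain ⟨Q, rfl⟩ := h.specOrderIso.surjective P
    rw [OrderIso.symm_apply_apply]
    exact ⟨by rw [← h.height_comap, ← h.specOrderIso_asIdeal, hP], hrP⟩

end IsTightQuadraticExtension

/-! ### From stable ideals of R to invertible ideals of S -/

/-- This says that S_Q is a valuation ring. If (y, z)J = (w) and w = yi + zj, then yi/w and zj/w lie
in S and sum to 1, so one of them is outside Q and serves as u. -/
lemma IsPruferDomain.exists_notMem_dvd {S : Type*} [CommRing S] [IsDomain S]
    (hS : IsPruferDomain S) (Q : Ideal S) [hQ : Q.IsPrime]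
    (y : S) {z : S} (hz : z ≠ 0) : ∃ u ∉ Q, z ∣ u * y ∨ y ∣ u * z := by
  have hne : Ideal.span {y, z} ≠ ⊥ := fun h0 => hz
    ((Submodule.eq_bot_iff _).1 h0 z (Ideal.subset_span (by simp)))
  obtain ⟨w, hw, J, hJ⟩ := (isUnit_coeIdeal_iff_exists_mul_eq_span _).1
    (hS _ hne (Submodule.fg_span (Set.toFinite _)))
  have hdvd : ∀ i ∈ J, w ∣ y * i ∧ w ∣ z * i := fun i hi => by
    constructor <;> rw [← Ideal.mem_span_singleton, ← hJ] <;>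
      exact Ideal.mul_mem_mul (Ideal.subset_span (by simp)) hi
  have hwJ : w ∈ Ideal.span {y, z} * J := hJ ▸ Ideal.mem_span_singleton_self w
  rw [Ideal.span_insert, Ideal.sup_mul, Submodule.mem_sup] at hwJ
  obtain ⟨p, hp, q, hq, hpq⟩ := hwJ
  obtain ⟨i, hi, rfl⟩ := Ideal.mem_span_singleton_mul.1 hp
  obtain ⟨j, hj, rfl⟩ := Ideal.mem_span_singleton_mul.1 hq
  obtain ⟨⟨a, ha⟩, c, hc⟩ := hdvd i hi
  obtain ⟨⟨b, hb⟩, d, hd⟩ := hdvd j hj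
  have had : a + d = 1 := mul_left_cancel₀ hw (by rw [mul_add, ← ha, ← hd, hpq, mul_one])
  by_cases haQ : a ∈ Q
  · refine ⟨d, fun hdQ => hQ.ne_top ((Ideal.eq_top_iff_one _).2 (had ▸ add_mem haQ hdQ)),
      Or.inl ⟨b, mul_left_cancel₀ hw ?_⟩⟩
    linear_combination z * hb - y * hd
  · refine ⟨a, haQ, Or.inr ⟨c, mul_left_cancel₀ hw ?_⟩⟩
    linear_combination y * hc - z * ha

/-- The endomorphism ring of a maximal ideal of a Prüfer domain is the domain itself. -/
lemma IsPruferDomain.dvd_of_mul_mem {S : Type*} [CommRing S] [IsDomain S]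
    (hS : IsPruferDomain S) {Q : Ideal S} (hQ : Q.IsMaximal)
    {y z : S} (hz : z ≠ 0) (h : ∀ q ∈ Q, y * q ∈ Ideal.span {z} * Q) : z ∣ y := by
  let D : Ideal S := Submodule.comap (LinearMap.mulRight S y) (Ideal.span {z})
  have hD : ∀ s, s ∈ D ↔ z ∣ s * y := fun s => Ideal.mem_span_singleton
  have hQD : Q ≤ D := fun q hq => by
    rw [hD, mul_comm, ← Ideal.mem_span_singleton]
    exact Ideal.mul_le_left (h q hq)
  suffices D = ⊤ by simpa [hD] using (Ideal.eq_top_iff_one _).1 this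
  by_contra hne
  have hQeq : Q = D := hQ.eq_of_le hne hQD
  -- If y/z ∈ S_Q, then u ∈ D = Q. Otherwise uz = yc: for c ∈ Q, the inclusion yQ ⊆ zQ forces u ∈ Q;
  -- for c ∉ Q, still c ∈ D = Q.
  obtain ⟨u, hu, hzu | ⟨c, hc⟩⟩ := hS.exists_notMem_dvd Q y hz
  · exact hu (hQeq ▸ (hD u).2 hzu)
  · by_cases hcQ : c ∈ Q
    · obtain ⟨q, hq, hqc⟩ := Ideal.mem_span_singleton_mul.1 (h c hcQ)
      refine hu ?_
      rwa [mul_left_cancel₀ hz (show z * u = z * q by rw [hqc, ← hc, mul_comm])]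
    · exact hcQ (hQeq ▸ (hD c).2 ⟨u, by rw [mul_comm c, ← hc, mul_comm]⟩)

/-- The determinant trick: y/z multiplies the finitely generated module I into itself, so it is
integral over R and lies in S. -/
lemma Ideal.FG.algebraMap_dvd_of_mul_mem {R : Type*} {S : Type*} [CommRing R] [CommRing S]
    [IsDomain S] [Algebra R S] [FaithfulSMul R S] [IsIntegrallyClosed S] {I : Ideal R} (hI : I ≠ ⊥)
    (hfg : I.FG) {y z : R} (hz : z ≠ 0) (h : ∀ b ∈ I, y * b ∈ Ideal.span {z} * I) :
    algebraMap R S z ∣ algebraMap R S y := by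
  let L := FractionRing S
  have hinj : Function.Injective (algebraMap R L) := by
    rw [IsScalarTower.algebraMap_eq R S L]
    exact (IsFractionRing.injective S L).comp (FaithfulSMul.algebraMap_injective R S)
  have hz' : algebraMap R L z ≠ 0 := by rwa [Ne, map_eq_zero_iff _ hinj]
  have hint : IsIntegral R (algebraMap R L y / algebraMap R L z) := by
    refine isIntegral_of_smul_mem_submodule (M := L) (Submodule.map (Algebra.linearMap R L) I)
      ?_ (Submodule.FG.map _ hfg) _ ?_
    · exact fun h0 => hI (Submodule.map_injective_of_injective (f := Algebra.linearMap R L) hinj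
        (h0.trans (Submodule.map_bot _).symm))
    · rintro _ ⟨b, hb, rfl⟩
      obtain ⟨m, hm, hmb⟩ := Ideal.mem_span_singleton_mul.1 (h b hb)
      refine ⟨m, hm, ?_⟩
      simp only [Algebra.linearMap_apply, smul_eq_mul]
      rw [div_mul_eq_mul_div, eq_div_iff hz', ← map_mul, ← map_mul, ← hmb, mul_comm]
  obtain ⟨s, hs⟩ := IsIntegrallyClosed.isIntegral_iff.1 (hint.tower_top (A := S))
  refine ⟨s, IsFractionRing.injective S L ?_⟩
  rw [eq_div_iff hz', IsScalarTower.algebraMap_apply R S L,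
    IsScalarTower.algebraMap_apply R S L, ← map_mul] at hs
  rw [← hs, mul_comm]

section StableToInvertible

variable {R : Type u} {S : Type v} [CommRing R] [CommRing S] [IsDomain R] [IsDomain S]
  [Algebra R S] [FaithfulSMul R S]

/-- A stable ideal whose endomorphism ring is contained in `S` extends to an invertible ideal. -/
lemma IsStableIdeal.isUnit_map {I : Ideal R} (hI : I ≠ ⊥) (h : IsStableIdeal I)
    (hdvd : ∀ y z : R, z ≠ 0 → (∀ b ∈ I, y * b ∈ Ideal.span {z} * I) →
      algebraMap R S z ∣ algebraMap R S y) :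
    IsUnit ((I.map (algebraMap R S) : Ideal S) : FractionalIdeal S⁰ (FractionRing S)) := by
  obtain ⟨z, hz, J, hJ, hzJ⟩ := h.exists_mul_le hI
  rw [isUnit_coeIdeal_iff_exists_mul_eq_span]
  refine ⟨algebraMap R S z, (FaithfulSMul.algebraMap_eq_zero_iff R S).not.2 hz,
    J.map (algebraMap R S), ?_⟩
  rw [← Ideal.map_mul]
  refine le_antisymm (Ideal.map_le_iff_le_comap.2 (Ideal.mul_le.2 fun a ha y hy => ?_))
    ((Ideal.span_singleton_le_iff_mem _).2 (Ideal.mem_map_of_mem _ hzJ))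
  -- Since J I² ⊆ zI, the fraction ya/z lies in (I : I).
  refine Ideal.mem_span_singleton.2 (hdvd _ _ hz fun b hb => ?_)
  rw [mul_comm a, mul_assoc]
  exact hJ (Ideal.mul_mem_mul hy (Ideal.mul_mem_mul ha hb))

/-- An integrally closed overring of a finitely stable domain, with the same quotient field, is
a Prüfer domain. -/
lemma IsFinitelyStableDomain.isPruferDomain [IsIntegrallyClosed S] (h : IsFinitelyStableDomain R)
    (hfrac : ∀ s : S, ∃ c : R, c ≠ 0 ∧ ∃ r : R, algebraMap R S r = algebraMap R S c * s) :
    IsPruferDomain S := by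
  classical
  rintro I hI ⟨t, rfl⟩
  have hden : ∃ c : R, c ≠ 0 ∧ ∀ s ∈ t, ∃ r : R, algebraMap R S r = algebraMap R S c * s := by
    clear hI
    induction t using Finset.induction_on with
    | empty => exact ⟨1, one_ne_zero, by simp⟩
    | insert s t _ ih =>
      obtain ⟨c, hc, ht⟩ := ih
      obtain ⟨d, hd, r, hr⟩ := hfrac s
      refine ⟨c * d, mul_ne_zero hc hd, fun x hx => ?_⟩
      rcases Finset.mem_insert.1 hx with rfl | hx
      · exact ⟨c * r, by rw [map_mul, map_mul, hr, mul_assoc]⟩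
      · obtain ⟨r', hr'⟩ := ht x hx
        exact ⟨d * r', by rw [map_mul, map_mul, hr']; ring⟩
  obtain ⟨c, hc, hct⟩ := hden
  choose! f hf using hct
  let J : Ideal R := Ideal.span (t.image f : Finset R)
  have hJmap : J.map (algebraMap R S) = Ideal.span {algebraMap R S c} * Ideal.span t := by
    rw [Ideal.map_span, Ideal.span_mul_span', Set.singleton_mul, Finset.coe_image, Set.image_image]
    congr 1
    exact Set.image_congr fun s hs => hf s hs
  have hc' : algebraMap R S c ≠ 0 := (FaithfulSMul.algebraMap_eq_zero_iff R S).not.2 hc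
  have hJ : J ≠ ⊥ := by
    intro h0
    rw [h0, Ideal.map_bot, eq_comm, Ideal.mul_eq_bot, Ideal.span_singleton_eq_bot] at hJmap
    exact hJmap.elim hc' hI
  have hJfg : J.FG := ⟨_, rfl⟩
  have hu := (h.2 J hJ hJfg).isUnit_map (S := S) hJ
    fun y z hz hyz => hJfg.algebraMap_dvd_of_mul_mem hJ hz hyz
  rw [hJmap, FractionalIdeal.coeIdeal_mul] at hu
  exact isUnit_of_mul_isUnit_right hu

/-- If `S` is Prüfer, a stable ideal of `R` that extends to a maximal ideal of `S` extends to an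
invertible ideal. -/
lemma IsStableIdeal.isUnit_map_of_isMaximal {P : Ideal R} (hP : P ≠ ⊥) (h : IsStableIdeal P)
    (hS : IsPruferDomain S) (hmax : (P.map (algebraMap R S)).IsMaximal) :
    IsUnit ((P.map (algebraMap R S) : Ideal S) : FractionalIdeal S⁰ (FractionRing S)) := by
  refine h.isUnit_map hP fun y z hz hyz => hS.dvd_of_mul_mem hmax
    ((FaithfulSMul.algebraMap_eq_zero_iff R S).not.2 hz) fun q hq => ?_
  rw [← Set.image_singleton, ← Ideal.map_span, ← Ideal.map_mul]
  induction hq using Submodule.span_induction with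
  | zero => simp
  | add a b _ _ ha hb => rw [mul_add]; exact add_mem ha hb
  | smul r a _ ha => rw [smul_eq_mul, mul_left_comm]; exact Ideal.mul_mem_left _ _ ha
  | mem a ha =>
    obtain ⟨b, hb, rfl⟩ := ha
    rw [← map_mul]
    exact Ideal.mem_map_of_mem _ (hyz b hb)

end StableToInvertible

/-! ### From invertible ideals of S to stable ideals of R -/

/-- An ideal `I` is stable if locally `I² = xI` for some `x ∈ I`. -/
lemma IsStableIdeal.of_forall_isMaximal {R : Type u} [CommRing R] [IsDomain R] {I : Ideal R}
    (h : ∀ M : Ideal R, M.IsMaximal → ∃ x ∈ I, ∃ d ∉ M,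
      ∀ a ∈ I, ∀ b ∈ I, d * (a * b) ∈ Ideal.span {x} * I) : IsStableIdeal I := by
  by_cases hI : I = ⊥
  · exact hI ▸ isStableIdeal_bot R
  obtain ⟨b, hb, hb0⟩ := Submodule.exists_mem_ne_zero_of_ne_bot hI
  let T : Set R := {d | ∃ x ∈ I, x ≠ 0 ∧ ∀ a ∈ I, ∀ b ∈ I, d * (a * b) ∈ Ideal.span {x} * I}
  have hT : Ideal.span T = ⊤ := by
    by_contra hne
    obtain ⟨M, hM, hle⟩ := Ideal.exists_le_maximal _ hne
    obtain ⟨x, hx, d, hd, hxd⟩ := h M hM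
    refine hd (hle (Ideal.subset_span ⟨x, hx, ?_, hxd⟩))
    rintro rfl
    have h0 := hxd b hb b hb
    rw [Ideal.span_singleton_zero, Ideal.bot_mul, Ideal.mem_bot] at h0
    simp only [mul_eq_zero, hb0, or_self, or_false] at h0
    exact hd (h0 ▸ M.zero_mem)
  -- The condition on e says e ∈ I · ((I : I) : I), witnessed by z⁻¹J; such e form an ideal, sums
  -- being handled with the common denominator zz'.
  have key : ∀ e ∈ Ideal.span T, ∃ z : R, z ≠ 0 ∧ ∃ J : Ideal R,
      J * (I * I) ≤ Ideal.span {z} * I ∧ z * e ∈ I * J := by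
    intro e he
    induction he using Submodule.span_induction with
    | zero => exact ⟨1, one_ne_zero, ⊥, by simp, by simp⟩
    | mem d hd =>
      obtain ⟨x, hx, hx0, hd⟩ := hd
      refine ⟨x, hx0, Ideal.span {d}, ?_, Ideal.mul_mem_mul hx (Ideal.mem_span_singleton_self d)⟩
      rw [Ideal.span_singleton_mul_le_iff]
      intro c hc
      induction hc using Submodule.mul_induction_on' with
      | mem_mul_mem a ha b hb => exact hd a ha b hb
      | add a _ b _ h1 h2 => rw [mul_add]; exact add_mem h1 h2
    | smul r e _ he =>
      obtain ⟨z, hz, J, hJ, hzJ⟩ := he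
      exact ⟨z, hz, J, hJ, by rw [smul_eq_mul, mul_left_comm]; exact Ideal.mul_mem_left _ _ hzJ⟩
    | add e e' _ _ he he' =>
      obtain ⟨z, hz, J, hJ, hzJ⟩ := he
      obtain ⟨z', hz', J', hJ', hzJ'⟩ := he'
      refine ⟨z * z', mul_ne_zero hz hz', Ideal.span {z'} * J ⊔ Ideal.span {z} * J', ?_, ?_⟩
      · rw [Ideal.sup_mul, ← Ideal.span_singleton_mul_span_singleton, mul_assoc (Ideal.span {z'}),
          mul_assoc (Ideal.span {z}), mul_assoc (Ideal.span {z})]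
        refine sup_le ?_ (Ideal.mul_mono le_rfl hJ')
        rw [mul_left_comm (Ideal.span {z})]
        exact Ideal.mul_mono le_rfl hJ
      · rw [Ideal.mul_sup, mul_add]
        refine Submodule.add_mem_sup ?_ ?_
        · rw [mul_left_comm I, mul_comm z z', mul_assoc]
          exact Ideal.mul_mem_mul (Ideal.mem_span_singleton_self _) hzJ
        · rw [mul_left_comm I, mul_assoc]
          exact Ideal.mul_mem_mul (Ideal.mem_span_singleton_self _) hzJ'
  obtain ⟨z, hz, J, hJ, hzJ⟩ := key 1 (hT ▸ Submodule.mem_top)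
  exact IsStableIdeal.of_exists_mul_le hz hJ (by rwa [mul_one] at hzJ)

namespace IsTightQuadraticExtension

variable {R : Type u} {S : Type v} [CommRing R] [CommRing S] [Algebra R S]

lemma map_comap_of_isMaximal (h : IsTightQuadraticExtension R S) {Q : Ideal S}
    (hQ : Q.IsMaximal) : (Q.comap (algebraMap R S)).map (algebraMap R S) = Q := by
  refine le_antisymm Ideal.map_comap_le fun s hs => ?_
  have := h.isIntegral
  have hmax : (Q.comap (algebraMap R S)).IsMaximal :=
    Ideal.isMaximal_comap_of_isIntegral_of_isMaximal Q
  obtain ⟨d, hd, hds⟩ := h.exists_mul_mem_map Q hQ.isPrime s hs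
  obtain ⟨r, p, hp, hrp⟩ := hmax.exists_inv hd
  have h1 : s = algebraMap R S r * (algebraMap R S d * s) + algebraMap R S p * s := by
    rw [← mul_assoc, ← add_mul, ← map_mul, ← map_add, hrp, map_one, one_mul]
  rw [h1]
  exact add_mem (Ideal.mul_mem_left _ _ hds) (Ideal.mul_mem_right _ _ (Ideal.mem_map_of_mem _ hp))

lemma comap_ne_bot [IsDomain R] [IsDomain S] (h : IsTightQuadraticExtension R S) {Q : Ideal S} (hQ : Q ≠ ⊥) :
    Q.comap (algebraMap R S) ≠ ⊥ := by
  have := h.isIntegral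
  exact fun h0 => hQ (Ideal.eq_bot_of_comap_eq_bot h0)

variable [FaithfulSMul R S]

lemma map_ne_bot {I : Ideal R} (hI : I ≠ ⊥) : I.map (algebraMap R S) ≠ ⊥ := by
  rwa [Ne, Ideal.map_eq_bot_iff_of_injective (FaithfulSMul.algebraMap_injective R S)]

/-- Multiply the quadratic relation for s = da/x and t = eb/x by x²: (da)(eb) = x(r₁da + r₂eb +
r₃x). -/
lemma mul_mul_mem_span_mul (h : IsTightQuadraticExtension R S) {I : Ideal R} {x a b d e : R}
    (hx : x ∈ I) (ha : a ∈ I) (hb : b ∈ I) (hda : algebraMap R S x ∣ algebraMap R S (d * a))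
    (heb : algebraMap R S x ∣ algebraMap R S (e * b)) :
    d * e * (a * b) ∈ Ideal.span {x} * I := by
  obtain ⟨s, hs⟩ := hda
  obtain ⟨t, ht⟩ := heb
  obtain ⟨r₁, r₂, r₃, hst⟩ := h.quadratic s t
  refine Ideal.mem_span_singleton_mul.2 ⟨r₁ * (d * a) + r₂ * (e * b) + r₃ * x,
    add_mem (add_mem (I.mul_mem_left _ (I.mul_mem_left _ ha))
      (I.mul_mem_left _ (I.mul_mem_left _ hb))) (I.mul_mem_left _ hx), ?_⟩
  apply FaithfulSMul.algebraMap_injective R S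
  rw [show d * e * (a * b) = d * a * (e * b) by ring]
  rw [map_mul, map_mul _ (d * a), hs, ht, map_add, map_add, map_mul _ r₁, map_mul _ r₂,
    map_mul _ r₃, hs, ht]
  linear_combination -(algebraMap R S x * algebraMap R S x) * hst

variable [IsDomain R] [IsDomain S]

/-- An ideal that extends to an invertible ideal is stable. -/
lemma isStableIdeal_of_isUnit_map (h : IsTightQuadraticExtension R S) {I : Ideal R}
    (hI : IsUnit ((I.map (algebraMap R S) : Ideal S) : FractionalIdeal S⁰ (FractionRing S))) :
    IsStableIdeal I := by
  obtain ⟨z, hz, J, hJ⟩ := (isUnit_coeIdeal_iff_exists_mul_eq_span _).1 hI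
  refine IsStableIdeal.of_forall_isMaximal fun M hM => ?_
  have := h.isIntegral
  obtain ⟨⟨Q, hQ⟩, hQM⟩ := Algebra.IsIntegral.comap_surjective R S ⟨M, hM.isPrime⟩
  replace hQM : Q.comap (algebraMap R S) = M := congrArg PrimeSpectrum.asIdeal hQM
  -- Such an x generates IS locally at Q; if none existed, (z) = IS · J would lie in zQ.
  obtain ⟨x, hx, j, hj, u, hu, hxj⟩ : ∃ x ∈ I, ∃ j ∈ J, ∃ u ∉ Q,
      algebraMap R S x * j = z * u := by
    by_contra! hcon
    have hle : Ideal.span {z} ≤ Ideal.span {z} * Q := by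
      rw [← hJ, Ideal.mul_comm, Ideal.mul_le, mul_comm J, hJ]
      intro j hj y hy
      induction hy using Submodule.span_induction with
      | zero => simp
      | add a b _ _ h1 h2 => rw [mul_add]; exact add_mem h1 h2
      | smul r a _ h1 => rw [smul_eq_mul, mul_left_comm]; exact Ideal.mul_mem_left _ _ h1
      | mem a ha =>
        obtain ⟨x, hx, rfl⟩ := ha
        obtain ⟨u, hu⟩ : z ∣ algebraMap R S x * j := by
          rw [← Ideal.mem_span_singleton, ← hJ]
          exact Ideal.mul_mem_mul (Ideal.mem_map_of_mem _ hx) hj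
        refine Ideal.mem_span_singleton_mul.2 ⟨u, ?_, by rw [← hu, mul_comm]⟩
        by_contra huQ
        exact hcon x hx j hj u huQ hu
    obtain ⟨q, hq, hzq⟩ := Ideal.mem_span_singleton_mul.1 (hle (Ideal.mem_span_singleton_self z))
    refine hQ.ne_top ((Ideal.eq_top_iff_one _).2 ?_)
    rwa [← mul_left_cancel₀ hz (hzq.trans (mul_one z).symm)]
  obtain ⟨v, r, hr, hrQ⟩ := h.exists_mul_notMem Q hQ u hu
  rw [hQM] at hrQ
  have hdvd : ∀ a ∈ I, algebraMap R S x ∣ algebraMap R S (r * a) := by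
    intro a ha
    obtain ⟨w, hw⟩ : z ∣ algebraMap R S a * j := by
      rw [← Ideal.mem_span_singleton, ← hJ]
      exact Ideal.mul_mem_mul (Ideal.mem_map_of_mem _ ha) hj
    refine ⟨v * w, mul_left_cancel₀ hz ?_⟩
    rw [map_mul, hr]
    linear_combination algebraMap R S x * v * hw - algebraMap R S a * v * hxj
  exact ⟨x, hx, r * r, fun hmem => hrQ ((hM.isPrime.mem_or_mem hmem).elim id id),
    fun a ha b hb => h.mul_mul_mem_span_mul hx ha hb (hdvd a ha) (hdvd b hb)⟩

/-! ### The Prüfer and Dedekind cases -/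

theorem isPruferDomain_iff [IsIntegrallyClosed S] (h : IsTightQuadraticExtension R S) :
    IsPruferDomain S ↔ IsFinitelyStableDomain R :=
  ⟨fun hS => ⟨inferInstance, fun _ hI hfg =>
      h.isStableIdeal_of_isUnit_map (hS _ (map_ne_bot hI) (hfg.map _))⟩,
    fun hR => hR.isPruferDomain h.exists_mul_eq⟩

theorem isDedekindDomain_iff [IsIntegrallyClosed S] (h : IsTightQuadraticExtension R S) :
    (IsDedekindDomain S ∧ ¬ IsField S) ↔ (IsStableDomain R ∧ ringKrullDim R = 1) := by
  rw [← h.ringKrullDim_eq]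
  constructor
  · rintro ⟨hS, hF⟩
    refine ⟨⟨inferInstance, fun I => ?_⟩, ?_⟩
    · by_cases hI : I = ⊥
      · exact hI ▸ isStableIdeal_bot R
      · refine h.isStableIdeal_of_isUnit_map (isUnit_iff_ne_zero.2 ?_)
        exact FractionalIdeal.coeIdeal_ne_zero.2 (map_ne_bot hI)
    · have : Ring.KrullDimLE 1 S := Ring.krullDimLE_one_iff_of_noZeroDivisors.2
        fun I hI hp => hp.isMaximal hI
      refine le_antisymm (by exact_mod_cast Ring.krullDimLE_iff.1 this) ?_
      by_contra! hlt
      have : Ring.KrullDimLE 0 S := Ring.krullDimLE_iff.2 (Order.le_of_lt_succ hlt)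
      exact hF Ring.KrullDimLE.isField_of_isDomain
  · rintro ⟨hR, hdim⟩
    have hP : IsPruferDomain S := h.isPruferDomain_iff.2 ⟨inferInstance, fun I _ _ => hR.2 I⟩
    have hle : Ring.KrullDimLE 1 S := Ring.krullDimLE_iff.2 (by rw [hdim]; rfl)
    refine ⟨?_, fun hF => by simp [ringKrullDim_eq_zero_of_isField hF] at hdim⟩
    have hnoeth : IsNoetherianRing S := by
      -- Cohen's theorem leaves only primes; a nonzero one is maximal, hence extended from its
      -- stable contraction and so invertible.
      refine IsNoetherianRing.of_prime fun Q hQ => ?_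
      by_cases hQ0 : Q = ⊥
      · exact hQ0 ▸ Submodule.fg_bot
      have hmax : Q.IsMaximal := Ideal.IsPrime.isMaximal_of_ne_bot hQ hQ0
      have hmap := h.map_comap_of_isMaximal hmax
      have hu := (hR.2 (Q.comap (algebraMap R S))).isUnit_map_of_isMaximal (S := S)
        (h.comap_ne_bot hQ0) hP (hmap.symm ▸ hmax)
      rw [hmap] at hu
      exact Ideal.fg_of_isUnit (IsFractionRing.injective S (FractionRing S)) Q hu
    have hd : Ring.DimensionLEOne S :=
      ⟨fun {p} hp hprime => Ideal.IsPrime.isMaximal_of_ne_bot hprime hp⟩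
    exact {}

end IsTightQuadraticExtension

/-! ### Localization at height one primes and the Krull case -/

namespace IsTightQuadraticExtension

variable {R : Type u} {S : Type v} [CommRing R] [CommRing S] [IsDomain R] [IsDomain S]
  [Algebra R S] [FaithfulSMul R S]

/-- An x of least value in I divides every element of I in the valuation ring S_Q, so the quadratic
relation gives I² = xI. -/
lemma isStableDomain_localization (h : IsTightQuadraticExtension R S) (Q : Ideal S) [Q.IsPrime]
    (hQ : IsDiscreteValuationRing (Localization.AtPrime Q)) :
    IsStableDomain (Localization.AtPrime (Q.comap (algebraMap R S))) := by
  set P := Q.comap (algebraMap R S)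
  let Rp := Localization.AtPrime P
  let Sq := Localization.AtPrime Q
  refine ⟨inferInstance, fun I => ?_⟩
  by_cases hI : I = ⊥
  · exact hI ▸ isStableIdeal_bot _
  let J : Ideal R := I.comap (algebraMap R Rp)
  have hinjR : Function.Injective (algebraMap R Rp) :=
    IsLocalization.injective _ P.primeCompl_le_nonZeroDivisors
  have hinjS : Function.Injective (algebraMap S Sq) :=
    IsLocalization.injective _ Q.primeCompl_le_nonZeroDivisors
  have hnum : ∀ α ∈ I, ∃ a ∈ J, ∃ s ∉ P, α * algebraMap R Rp s = algebraMap R Rp a := by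
    intro α hα
    obtain ⟨⟨a, s⟩, has⟩ := IsLocalization.surj P.primeCompl α
    exact ⟨a, by rw [Ideal.mem_comap, ← has]; exact I.mul_mem_right _ hα, s, s.2, has⟩
  have hJ : ∃ x, x ∈ J ∧ x ≠ 0 := by
    obtain ⟨α, hα, hα0⟩ := Submodule.exists_mem_ne_zero_of_ne_bot hI
    obtain ⟨a, ha, s, hs, has⟩ := hnum α hα
    refine ⟨a, ha, ?_⟩
    rintro rfl
    rw [map_zero, mul_eq_zero, map_eq_zero_iff _ hinjR] at has
    exact has.elim hα0 fun hs0 => hs (hs0 ▸ P.zero_mem)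
  obtain ⟨x, ⟨hx, hx0⟩, hmin⟩ := exists_minimalFor_of_wellFoundedLT (fun x => x ∈ J ∧ x ≠ 0)
    (fun x => IsDiscreteValuationRing.addVal Sq (algebraMap S Sq (algebraMap R S x))) hJ
  have hdvd : ∀ a ∈ J, ∃ d ∉ P, algebraMap R S x ∣ algebraMap R S (d * a) := by
    intro a ha
    have hval : algebraMap S Sq (algebraMap R S x) ∣ algebraMap S Sq (algebraMap R S a) := by
      by_cases ha0 : a = 0
      · simp [ha0]
      rw [← IsDiscreteValuationRing.addVal_le_iff_dvd]
      exact (le_total _ _).elim id fun hle => hmin ⟨ha, ha0⟩ hle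
    obtain ⟨w, hw⟩ := hval
    obtain ⟨⟨t, u⟩, htu⟩ := IsLocalization.surj Q.primeCompl w
    have htu' : algebraMap R S a * u = algebraMap R S x * t := by
      apply hinjS
      rw [map_mul, map_mul, hw, ← htu, mul_assoc]
    obtain ⟨v, r, hr, hrQ⟩ := h.exists_mul_notMem Q ‹_› u u.2
    refine ⟨r, hrQ, t * v, ?_⟩
    rw [map_mul, hr]
    linear_combination v * htu'
  have hx' : algebraMap R Rp x ≠ 0 := by rwa [Ne, map_eq_zero_iff _ hinjR]
  refine IsStableIdeal.of_exists_mul_le (J := ⊤) hx' ?_ (by rwa [Ideal.mul_top])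
  rw [Ideal.top_mul, Ideal.mul_le]
  intro α hα β hβ
  obtain ⟨a, ha, s, hs, has⟩ := hnum α hα
  obtain ⟨b, hb, t, ht, hbt⟩ := hnum β hβ
  obtain ⟨d, hd, hda⟩ := hdvd a ha
  obtain ⟨e, he, heb⟩ := hdvd b hb
  have hmem := Ideal.mem_map_of_mem (algebraMap R Rp) (h.mul_mul_mem_span_mul hx ha hb hda heb)
  rw [Ideal.map_mul, Ideal.map_span, Set.image_singleton] at hmem
  have hunit : ∀ r ∉ P, IsUnit (algebraMap R Rp r) := fun r hr =>
    IsLocalization.map_units Rp (⟨r, hr⟩ : P.primeCompl)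
  rw [← Ideal.unit_mul_mem_iff_mem _
    ((((hunit d hd).mul (hunit e he)).mul (hunit s hs)).mul (hunit t ht))]
  have hEq : algebraMap R Rp d * algebraMap R Rp e * algebraMap R Rp s * algebraMap R Rp t *
      (α * β) = algebraMap R Rp (d * e * (a * b)) := by
    simp only [map_mul]
    rw [← has, ← hbt]
    ring
  rw [hEq]
  exact Ideal.mul_mono le_rfl Ideal.map_comap_le hmem

/-- S_Q is Prüfer as an integrally closed overring of the stable domain R_P. The stable ideal PR_P
extends to QS_Q, which is thus invertible, hence principal; as S_Q has dimension one, all its primes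
are principal. -/
lemma isDiscreteValuationRing_localization [IsIntegrallyClosed S]
    (h : IsTightQuadraticExtension R S) (Q : Ideal S) [hQp : Q.IsPrime] (hQ : Q.height = 1)
    (hR : IsStableDomain (Localization.AtPrime (Q.comap (algebraMap R S)))) :
    IsDiscreteValuationRing (Localization.AtPrime Q) := by
  set P := Q.comap (algebraMap R S) with hP
  let Rp := Localization.AtPrime P
  let Sq := Localization.AtPrime Q
  let f : Rp →+* Sq := Localization.localRingHom P Q (algebraMap R S) rfl
  let : Algebra Rp Sq := f.toAlgebra
  have hinjR : Function.Injective (algebraMap R Rp) :=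
    IsLocalization.injective _ P.primeCompl_le_nonZeroDivisors
  have hinjS : Function.Injective (algebraMap S Sq) :=
    IsLocalization.injective _ Q.primeCompl_le_nonZeroDivisors
  have hf : ∀ r : R, algebraMap Rp Sq (algebraMap R Rp r) = algebraMap S Sq (algebraMap R S r) :=
    fun r => Localization.localRingHom_to_map P Q (algebraMap R S) rfl r
  have hunit : ∀ r ∉ P, IsUnit (algebraMap R Rp r) := fun r hr =>
    IsLocalization.map_units Rp (⟨r, hr⟩ : P.primeCompl)
  have hfaith : FaithfulSMul Rp Sq := by
    rw [faithfulSMul_iff_algebraMap_injective, injective_iff_map_eq_zero]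
    intro α hα
    obtain ⟨⟨a, s⟩, has⟩ := IsLocalization.surj P.primeCompl α
    have h0 := congrArg (algebraMap Rp Sq) has
    rw [map_mul, hα, zero_mul, hf, eq_comm, map_eq_zero_iff _ hinjS,
      FaithfulSMul.algebraMap_eq_zero_iff] at h0
    refine ((hunit s s.2).mul_left_eq_zero).1 (has.trans ?_)
    exact (congrArg (algebraMap R Rp) h0).trans (map_zero _)
  have hic : IsIntegrallyClosed Sq :=
    isIntegrallyClosed_of_isLocalization Sq Q.primeCompl Q.primeCompl_le_nonZeroDivisors
  have hfrac : ∀ σ : Sq, ∃ c : Rp, c ≠ 0 ∧ ∃ ρ : Rp,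
      algebraMap Rp Sq ρ = algebraMap Rp Sq c * σ := by
    intro σ
    obtain ⟨⟨s, u⟩, hsu⟩ := IsLocalization.surj Q.primeCompl σ
    obtain ⟨v, r, hr, hrQ⟩ := h.exists_mul_notMem Q ‹_› u u.2
    obtain ⟨c, hc, t, ht⟩ := h.exists_mul_eq (v * s)
    refine ⟨algebraMap R Rp (c * r), ?_, algebraMap R Rp t, ?_⟩
    · rw [Ne, map_eq_zero_iff _ hinjR]
      exact mul_ne_zero hc fun h0 => hrQ (h0 ▸ P.zero_mem)
    · rw [hf, hf, ht, map_mul (algebraMap R S), hr]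
      simp only [map_mul]
      rw [← hsu]
      ring
  have hprufer : IsPruferDomain Sq :=
    IsFinitelyStableDomain.isPruferDomain (R := Rp) ⟨inferInstance, fun I _ _ => hR.2 I⟩ hfrac
  have hmaxR : IsLocalRing.maximalIdeal Rp = P.map (algebraMap R Rp) :=
    Localization.AtPrime.map_eq_maximalIdeal.symm
  have hmaxS : IsLocalRing.maximalIdeal Sq = Q.map (algebraMap S Sq) :=
    Localization.AtPrime.map_eq_maximalIdeal.symm
  have hcomp : (algebraMap Rp Sq).comp (algebraMap R Rp) =
      (algebraMap S Sq).comp (algebraMap R S) := RingHom.ext hf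
  have hmap : (IsLocalRing.maximalIdeal Rp).map (algebraMap Rp Sq) =
      IsLocalRing.maximalIdeal Sq := by
    rw [hmaxR, hmaxS, Ideal.map_map, hcomp, ← Ideal.map_map]
    refine le_antisymm (Ideal.map_mono Ideal.map_comap_le) (Ideal.map_le_iff_le_comap.2 ?_)
    intro s hs
    obtain ⟨d, hd, hds⟩ := h.exists_mul_mem_map Q ‹_› s hs
    have hmem := Ideal.mem_map_of_mem (algebraMap S Sq) hds
    rw [map_mul] at hmem
    have hdu : IsUnit (algebraMap S Sq (algebraMap R S d)) :=
      IsLocalization.map_units Sq (⟨_, hd⟩ : Q.primeCompl)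
    exact (Ideal.unit_mul_mem_iff_mem _ hdu).1 hmem
  have hQ0 : Q ≠ ⊥ := by
    rintro rfl
    simp at hQ
  have hmaxR0 : IsLocalRing.maximalIdeal Rp ≠ ⊥ := by
    rw [hmaxR, Ne, Ideal.map_eq_bot_iff_of_injective hinjR]
    exact h.comap_ne_bot hQ0
  have hu := (hR.2 (IsLocalRing.maximalIdeal Rp)).isUnit_map_of_isMaximal (S := Sq) hmaxR0 hprufer
    (hmap ▸ IsLocalRing.maximalIdeal.isMaximal Sq)
  rw [hmap] at hu
  have hprin : (IsLocalRing.maximalIdeal Sq).IsPrincipal :=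
    Ideal.IsPrincipal.of_finite_maximals_of_isUnit
      ((Set.finite_singleton (IsLocalRing.maximalIdeal Sq)).subset
        fun I hI => IsLocalRing.eq_maximalIdeal hI) hu
  have hdim : ringKrullDim Sq = 1 := by
    rw [IsLocalization.AtPrime.ringKrullDim_eq_height Q Sq, hQ]
    rfl
  have hle : Ring.KrullDimLE 1 Sq := Ring.krullDimLE_iff.2 (by rw [hdim]; rfl)
  have hpid : IsPrincipalIdealRing Sq := by
    refine IsPrincipalIdealRing.of_prime fun 𝔮 h𝔮 => ?_
    by_cases h0 : 𝔮 = ⊥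
    · exact h0 ▸ bot_isPrincipal
    · rw [IsLocalRing.eq_maximalIdeal (Ideal.IsPrime.isMaximal_of_ne_bot h𝔮 h0)]
      exact hprin
  exact { not_a_field' := by
            rw [hmaxS, Ne, Ideal.map_eq_bot_iff_of_injective hinjS]
            exact hQ0 }

theorem isKrullDomain_iff [IsIntegrallyClosed S] (h : IsTightQuadraticExtension R S) :
    IsKrullDomain S ↔ (IsInterHeightOneLocalizations S ∧ HeightOneFiniteCharacter R ∧
      ∀ P : PrimeSpectrum R, P.asIdeal.height = 1 →
        IsStableDomain (Localization.AtPrime P.asIdeal)) := by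
  rw [h.heightOneFiniteCharacter_iff]
  constructor
  · intro hS
    refine ⟨hS.isInter, hS.finiteCharacter, fun P hP => ?_⟩
    obtain ⟨Q, rfl⟩ := h.specOrderIso.surjective P
    exact h.isStableDomain_localization Q.asIdeal
      (hS.isDVR Q (by rw [← h.height_comap, ← h.specOrderIso_asIdeal, hP]))
  · rintro ⟨hinter, hfin, hstable⟩
    refine ⟨fun Q hQ => ?_, hinter, hfin⟩
    exact h.isDiscreteValuationRing_localization Q.asIdeal hQ
      (hstable (h.specOrderIso Q) (by rw [h.specOrderIso_asIdeal, h.height_comap, hQ]))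

end IsTightQuadraticExtension

theorem theorem7p1 {S : Type u} [CommRing S] [IsDomain S] [IsIntegrallyClosed S]
    (C : Submonoid S) (R : Subring S)
    (K : Type v) [AddCommGroup K] [Module S K] (hR : IsTwistedAlong R C K) :
    (IsPruferDomain S ↔ IsFinitelyStableDomain R) ∧
    ((IsDedekindDomain S ∧ ¬ IsField S) ↔ (IsStableDomain R ∧ ringKrullDim R = 1)) ∧
    (IsKrullDomain S ↔
      (IsInterHeightOneLocalizations S ∧ HeightOneFiniteCharacter R ∧
        ∀ P : PrimeSpectrum R, P.asIdeal.height = 1 →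
          IsStableDomain (Localization.AtPrime P.asIdeal))) :=
  have h := hR.isTightQuadraticExtension
  ⟨h.isPruferDomain_iff, h.isDedekindDomain_iff, h.isKrullDomain_iff⟩
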